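/- For $m\ge 0$ let $$P_m(x)=2^{-2m}\sum_{k=0}^m 2^k\binom{2m-2k}{m-k}\binom{m+k}{k}(x+1)^k$$ be the Boros–Moll polynomial, and let $d_\ell(m)$ denote the coefficient of $x^\ell$ in $P_m(x)$, that is, $$d_\ell(m)=2^{-2m}\sum_{k=\ell}^m 2^k\binom{2m-2k}{m-k}\binom{m+k}{k}\binom{k}{\ell}\qquad(0\le\ell\le m).$$ Then for all integers $m\ge 3$ and $1\le \ell\le m-2$, $$4\bigl(d_\ell(m)^2-d_{\ell-1}(m)d_{\ell+1}(m)\bigr)\bigl(d_{\ell+1}(m)^2-d_\ell(m)d_{\ell+2}(m)\bigr)>\bigl(d_\ell(m)d_{\ell+1}(m)-d_{\ell-1}(m)d_{\ell+2}(m)\bigr)^2 .$$ -/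

import Mathlib

/-- The Boros–Moll polynomial
`P_m(x) = 2^{-2m} ∑_{k=0}^m 2^k * binom(2m-2k, m-k) * binom(m+k, k) * (x+1)^k`. -/
noncomputable def borosMollPoly (m : ℕ) : Polynomial ℝ :=
  Polynomial.C (((2 : ℝ) ^ (2 * m))⁻¹) *
    ∑ k ∈ Finset.range (m + 1),
      Polynomial.C ((2 : ℝ) ^ k * ((2 * m - 2 * k).choose (m - k) : ℝ) * ((m + k).choose k : ℝ)) *
        (Polynomial.X + 1) ^ k

/-- `borosMoll ℓ m` is `d_ℓ(m)`, the coefficient of `x ^ ℓ` in `P_m(x)`. -/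
noncomputable def borosMoll (ℓ m : ℕ) : ℝ :=
  (borosMollPoly m).coeff ℓ

/-- The explicit formula
`d_ℓ(m) = 2^{-2m} ∑_{k=ℓ}^m 2^k * binom(2m-2k, m-k) * binom(m+k, k) * binom(k, ℓ)`. -/
theorem borosMoll_eq_sum (ℓ m : ℕ) :
    borosMoll ℓ m = ((2 : ℝ) ^ (2 * m))⁻¹ *
      ∑ k ∈ Finset.Icc ℓ m, (2 : ℝ) ^ k * ((2 * m - 2 * k).choose (m - k) : ℝ) *
        ((m + k).choose k : ℝ) * (k.choose ℓ : ℝ) := by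
  unfold borosMoll borosMollPoly
  rw [Polynomial.coeff_C_mul, Polynomial.finsetSum_coeff]
  congr 1
  simp only [Polynomial.coeff_C_mul, Polynomial.coeff_X_add_one_pow]
  symm
  apply Finset.sum_subset
  · intro k hk
    simp only [Finset.mem_Icc, Finset.mem_range] at *
    omega
  · intro k hk hk'
    simp only [Finset.mem_Icc, Finset.mem_range] at *
    rw [Nat.choose_eq_zero_of_lt (by omega : k < ℓ)]
    simp

/-! Put u = d_{ℓ-1}d_{ℓ+1}/d_ℓ² and v = d_ℓ d_{ℓ+2}/d_{ℓ+1}². Dividing by d_ℓ² d_{ℓ+1}² turns the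
claim into 4(1-u)(1-v) > (1-uv)², so tight bounds on u and v suffice. They come from a recurrence in
ℓ at fixed m (`borosMoll_recurrence`), the coefficient form of (1-x²)P'' - (2x+2m+1)P' + m(m+1)P =
0. With M = m+1/2 and L = ℓ+1/2, the shifted ratio w_ℓ = `borosMollDefect ℓ m` satisfies w_ℓ(M +
w_{ℓ+1}) = M w_{ℓ+1} + L². Backward induction from w_m = M traps w_ℓ, hence u and v
(`borosMoll_turan_bounds`). The form is concave in u and in v separately, so only the four corners
of the resulting rectangle need checking. -/

/-! ### The three-term recurrence in the coefficient index -/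

/-- The coefficient of `(x + 1) ^ k` in `2 ^ (2 * m) * P_m(x)`. -/
noncomputable def borosMollShiftCoeff (m k : ℕ) : ℝ :=
  (2 : ℝ) ^ k * ((2 * m - 2 * k).choose (m - k) : ℝ) * ((m + k).choose k : ℝ)

theorem borosMollShiftCoeff_pos {m k : ℕ} (hk : k ≤ m) : 0 < borosMollShiftCoeff m k := by
  unfold borosMollShiftCoeff
  have h1 : 0 < (2 * m - 2 * k).choose (m - k) := Nat.choose_pos (by omega)
  have h2 : 0 < (m + k).choose k := Nat.choose_pos (by omega)
  positivity

theorem borosMollShiftCoeff_succ {m k : ℕ} (hk : k < m) :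
    ((k : ℝ) + 1) * (2 * m - 2 * k - 1) * borosMollShiftCoeff m (k + 1) =
      ((m : ℝ) - k) * (m + k + 1) * borosMollShiftCoeff m k := by
  obtain ⟨n, rfl⟩ : ∃ n, m = k + n + 1 := ⟨m - k - 1, by omega⟩
  unfold borosMollShiftCoeff
  have e1 : 2 * (k + n + 1) - 2 * k = 2 * (n + 1) := by omega
  have e2 : 2 * (k + n + 1) - 2 * (k + 1) = 2 * n := by omega
  have e3 : k + n + 1 - k = n + 1 := by omega
  have e4 : k + n + 1 - (k + 1) = n := by omega
  rw [e1, e2, e3, e4]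
  have h1 : ((n : ℝ) + 1) * ((2 * (n + 1)).choose (n + 1) : ℝ) =
      2 * (2 * n + 1) * ((2 * n).choose n : ℝ) := by
    have := Nat.succ_mul_centralBinom_succ n
    unfold Nat.centralBinom at this
    exact_mod_cast this
  have h2 : ((k : ℝ) + n + 1 + k + 1) * ((k + n + 1 + k).choose k : ℝ) =
      ((k + n + 1 + (k + 1)).choose (k + 1) : ℝ) * (k + 1) := by
    have := Nat.add_one_mul_choose_eq (k + n + 1 + k) k
    exact_mod_cast this
  push_cast
  rw [pow_succ]
  linear_combination
    (-((2 * n + 1) * 2 ^ k * 2 * ((2 * n).choose n : ℝ))) * h2 -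
      (2 ^ k * ((k : ℝ) + n + 1 + k + 1) * ((k + n + 1 + k).choose k : ℝ)) * h1

theorem cast_succ_mul_choose_succ (k j : ℕ) :
    ((j : ℝ) + 1) * (k.choose (j + 1) : ℝ) = ((k : ℝ) - j) * (k.choose j : ℝ) := by
  rcases le_or_gt j k with h | h
  · have := Nat.choose_succ_right_eq k j
    have h' : ((k.choose (j + 1) * (j + 1) : ℕ) : ℝ) = (k.choose j * (k - j) : ℕ) := by rw [this]
    push_cast [Nat.cast_sub h] at h'
    linarith
  · rw [Nat.choose_eq_zero_of_lt h, Nat.choose_eq_zero_of_lt (by omega)]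
    simp

theorem cast_succ_mul_choose (k j : ℕ) :
    ((k : ℝ) + 1) * (k.choose j : ℝ) = ((k : ℝ) + 1 - j) * ((k + 1).choose j : ℝ) := by
  have h1 := cast_succ_mul_choose_succ (k + 1) j
  have h2 := Nat.add_one_mul_choose_eq k j
  have h3 : ((k : ℝ) + 1) * (k.choose j : ℝ) = ((k + 1).choose (j + 1) : ℝ) * (j + 1) := by
    exact_mod_cast h2
  push_cast at h1
  linarith

/-- By `key` and `borosMollShiftCoeff_succ`, the k-th summand is T_k - T_{k-1}, where T_n is the
right-hand side. Since T_m = 0, the case n = m is the recurrence. -/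
theorem sum_borosMollShiftCoeff_telescope (m j n : ℕ) (hn : n ≤ m) :
    ∑ k ∈ Finset.range (n + 1), borosMollShiftCoeff m k *
        (((m : ℝ) - j) * (m + j + 1) * (k.choose j : ℝ) +
          (j + 1) * (j + 2) * (k.choose (j + 2) : ℝ) -
          (2 * m + 1) * (j + 1) * (k.choose (j + 1) : ℝ)) =
      ((m : ℝ) - n) * (m + n + 1) * borosMollShiftCoeff m n * (n.choose j : ℝ) := by
  have key : ∀ k : ℕ, ((m : ℝ) - j) * (m + j + 1) * (k.choose j : ℝ) +
          (j + 1) * (j + 2) * (k.choose (j + 2) : ℝ) -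
          (2 * m + 1) * (j + 1) * (k.choose (j + 1) : ℝ) =
        (((m : ℝ) - k) * (m + k + 1) - (2 * m + 1 - 2 * k) * (k - j)) * (k.choose j : ℝ) := by
    intro k
    have h1 := cast_succ_mul_choose_succ k j
    have h2 := cast_succ_mul_choose_succ k (j + 1)
    push_cast at h2
    linear_combination ((k : ℝ) - j - 1 - (2 * m + 1)) * h1 + ((j : ℝ) + 1) * h2
  induction n with
  | zero =>
    rw [zero_add, Finset.sum_range_one, key]
    rcases Nat.eq_zero_or_pos j with rfl | h
    · simp; ring
    · rw [Nat.choose_eq_zero_of_lt h]; simp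
  | succ n ih =>
    rw [Finset.sum_range_succ, ih (by omega), key]
    have h1 := borosMollShiftCoeff_succ (show n < m by omega)
    have h2 := cast_succ_mul_choose n j
    push_cast
    linear_combination (-(n.choose j : ℝ)) * h1 +
      (2 * m - 2 * n - 1) * borosMollShiftCoeff m (n + 1) * h2

theorem borosMoll_eq_sum_range (ℓ m : ℕ) :
    borosMoll ℓ m = ((2 : ℝ) ^ (2 * m))⁻¹ *
      ∑ k ∈ Finset.range (m + 1), borosMollShiftCoeff m k * (k.choose ℓ : ℝ) := by
  unfold borosMoll borosMollPoly borosMollShiftCoeff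
  rw [Polynomial.coeff_C_mul, Polynomial.finsetSum_coeff]
  simp only [Polynomial.coeff_C_mul, Polynomial.coeff_X_add_one_pow]

theorem borosMoll_recurrence (m j : ℕ) :
    ((m : ℝ) - j) * (m + j + 1) * borosMoll j m + (j + 1) * (j + 2) * borosMoll (j + 2) m =
      (2 * m + 1) * (j + 1) * borosMoll (j + 1) m := by
  have h := sum_borosMollShiftCoeff_telescope m j m le_rfl
  rw [sub_self, zero_mul, zero_mul, zero_mul] at h
  simp only [mul_sub, mul_add, Finset.sum_sub_distrib, Finset.sum_add_distrib,
    mul_left_comm (borosMollShiftCoeff _ _), ← Finset.mul_sum] at h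
  simp only [borosMoll_eq_sum_range]
  linear_combination ((2 : ℝ) ^ (2 * m))⁻¹ * h

theorem borosMoll_pos {ℓ m : ℕ} (h : ℓ ≤ m) : 0 < borosMoll ℓ m := by
  rw [borosMoll_eq_sum_range]
  refine mul_pos (by positivity) (Finset.sum_pos' (fun k hk => ?_) ⟨m, by simp, ?_⟩)
  · have := borosMollShiftCoeff_pos (Nat.lt_succ_iff.mp (Finset.mem_range.mp hk))
    positivity
  · have h1 := borosMollShiftCoeff_pos (le_refl m)
    have h2 : 0 < m.choose ℓ := Nat.choose_pos h
    positivity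

theorem borosMoll_succ_self (m : ℕ) : borosMoll (m + 1) m = 0 := by
  rw [borosMoll_eq_sum]
  simp

/-! ### Two-sided bounds on consecutive ratios -/

/-- The ratio `d_{ℓ+1}(m) / d_ℓ(m)` in the coordinate in which the recurrence becomes the
Riccati equation `borosMollDefect_succ`. -/
noncomputable def borosMollDefect (ℓ m : ℕ) : ℝ :=
  m + 1 / 2 - (ℓ + 1) * (borosMoll (ℓ + 1) m / borosMoll ℓ m)

theorem borosMoll_succ_eq {ℓ m : ℕ} (h : ℓ ≤ m) :
    (ℓ + 1) * borosMoll (ℓ + 1) m = (m + 1 / 2 - borosMollDefect ℓ m) * borosMoll ℓ m := by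
  have := (borosMoll_pos h).ne'
  unfold borosMollDefect
  field_simp
  ring

theorem borosMollDefect_self (m : ℕ) : borosMollDefect m m = m + 1 / 2 := by
  simp [borosMollDefect, borosMoll_succ_self]

theorem borosMoll_eq_succ {ℓ m : ℕ} (h : ℓ < m) :
    ((m : ℝ) - ℓ) * (m + ℓ + 1) * borosMoll ℓ m =
      (ℓ + 1) * (m + 1 / 2 + borosMollDefect (ℓ + 1) m) * borosMoll (ℓ + 1) m := by
  have h1 := borosMoll_recurrence m ℓ
  have h2 := borosMoll_succ_eq (show ℓ + 1 ≤ m by omega)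
  push_cast at h2
  linear_combination h1 - ((ℓ : ℝ) + 1) * h2

theorem borosMollDefect_succ {ℓ m : ℕ} (h : ℓ < m) :
    borosMollDefect ℓ m * (m + 1 / 2 + borosMollDefect (ℓ + 1) m) =
      (m + 1 / 2) * borosMollDefect (ℓ + 1) m + (ℓ + 1 / 2) ^ 2 := by
  have h1 := borosMoll_eq_succ h
  have h2 := borosMoll_succ_eq h.le
  have h3 := (borosMoll_pos h.le).ne'
  apply mul_right_cancel₀ h3
  linear_combination (m + 1 / 2 + borosMollDefect (ℓ + 1) m) * h2 + h1

/-- One backward step of the Riccati recursion preserves the lower bound. -/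
theorem riccati_lower_step {L M w w' : ℝ} (hL : 1 / 2 ≤ L) (hM : L + 1 ≤ M)
    (hw : L + 1 + (M - (L + 1)) * (L + 1) / (2 * ((L + 1) ^ 2 + M)) ≤ w)
    (h : w' * (M + w) = M * w + L ^ 2) :
    L + (M - L) * L / (2 * (L ^ 2 + M)) ≤ w' := by
  obtain ⟨a, rfl⟩ : ∃ a, L = a + 1 / 2 := ⟨L - 1 / 2, by ring⟩
  obtain ⟨b, rfl⟩ : ∃ b, M = a + 1 / 2 + 1 + b := ⟨M - (a + 1 / 2 + 1), by ring⟩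
  have ha : 0 ≤ a := by linarith
  have hb : 0 ≤ b := by linarith
  set L := a + 1 / 2 with hLd
  set M := L + 1 + b with hMd
  set y := (M - (L + 1)) * (L + 1) / (2 * ((L + 1) ^ 2 + M)) with hy
  set y' := (M - L) * L / (2 * (L ^ 2 + M)) with hy'
  have hLp : 0 < L := by linarith
  have hMp : 0 < M := by linarith
  have hy0 : 0 ≤ y := by
    rw [hy, hMd, add_sub_cancel_left]; positivity
  -- M - L - y' is the coefficient of w in M w + L² - (L + y')(M + w); its sign reduces the claim to
  -- the least admissible w, treated in `hstep`.
  have hy1 : y' ≤ M - L := by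
    rw [hy', div_le_iff₀ (by positivity)]
    nlinarith [mul_nonneg (show 0 ≤ M - L by linarith) (sq_nonneg (L - 1)),
      mul_nonneg (show 0 ≤ M - L by linarith) hMp.le, mul_nonneg (show 0 ≤ M - L by linarith) hLp.le]
  have hstep : (L + y') * (M + (L + 1 + y)) ≤ M * (L + 1 + y) + L ^ 2 := by
    rw [← sub_nonneg]
    have : M * (L + 1 + y) + L ^ 2 - (L + y') * (M + (L + 1 + y)) =
        ((M * ((L + 1) * (2 * ((L + 1) ^ 2 + M)) + (M - (L + 1)) * (L + 1)) +
          L ^ 2 * (2 * ((L + 1) ^ 2 + M))) * (2 * (L ^ 2 + M)) -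
          (L * (2 * (L ^ 2 + M)) + (M - L) * L) *
          ((M + L + 1) * (2 * ((L + 1) ^ 2 + M)) + (M - (L + 1)) * (L + 1))) /
          ((2 * ((L + 1) ^ 2 + M)) * (2 * (L ^ 2 + M))) := by
      rw [hy, hy']
      field_simp
      ring
    rw [this]
    apply div_nonneg _ (by positivity)
    -- In terms of a, b ≥ 0 the numerator expands with no negative coefficient.
    rw [hMd, hLd]
    ring_nf
    positivity
  have hpos : 0 < M + w := by linarith
  refine le_of_mul_le_mul_right ?_ hpos
  rw [h]
  nlinarith [mul_nonneg (show 0 ≤ M - L - y' by linarith) (sub_nonneg.2 hw)]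

/-- One backward step of the Riccati recursion preserves the upper bound. -/
theorem riccati_upper_step {L M w w' : ℝ} (hL : 0 < L) (hM : L + 1 ≤ M)
    (hw0 : 0 < w) (hw : w ^ 2 ≤ (L + 1) ^ 2 + M - (L + 1))
    (h : w' * (M + w) = M * w + L ^ 2) :
    w' ^ 2 ≤ L ^ 2 + M - L := by
  -- B is the largest admissible w. As L ≤ M, the map w ↦ (M w + L²)/(M + w) is increasing, so w = B
  -- is the worst case.
  set B := Real.sqrt ((L + 1) ^ 2 + M - (L + 1)) with hB
  have hBsq : B ^ 2 = (L + 1) ^ 2 + M - (L + 1) := Real.sq_sqrt (by nlinarith)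
  have hB0 : 0 ≤ B := Real.sqrt_nonneg _
  have hLB : L ≤ B := by
    apply Real.le_sqrt_of_sq_le
    nlinarith
  have hwB : w ≤ B := by
    apply Real.le_sqrt_of_sq_le hw
  have hpos : 0 < M + w := by linarith
  have hposB : 0 < M + B := by linarith
  have hw' : w' = (M * w + L ^ 2) / (M + w) := by
    rw [eq_div_iff hpos.ne']; exact h
  have hmono : w' ≤ (M * B + L ^ 2) / (M + B) := by
    rw [hw', div_le_div_iff₀ hpos hposB]
    nlinarith [mul_nonneg (show 0 ≤ M ^ 2 - L ^ 2 by nlinarith) (sub_nonneg.2 hwB)]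
  have hw'0 : 0 ≤ w' := by
    rw [hw']
    have : 0 < M := by linarith
    positivity
  calc w' ^ 2 ≤ ((M * B + L ^ 2) / (M + B)) ^ 2 := by gcongr
    _ ≤ L ^ 2 + M - L := by
      rw [div_pow, div_le_iff₀ (by positivity), ← sub_nonneg]
      have : (L ^ 2 + M - L) * (M + B) ^ 2 - (M * B + L ^ 2) ^ 2 =
          (M - L) * (2 * M * (B - L) + M + L) := by
        linear_combination (L ^ 2 + M - L - M ^ 2) * hBsq
      rw [this]
      have h1 : 0 ≤ M - L := by linarith
      have h2 : 0 ≤ B - L := by linarith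
      have h3 : 0 ≤ M := by linarith
      positivity

/-- Both bounds are equalities at ℓ = m, and the Riccati steps carry them down in ℓ. -/
theorem borosMollDefect_bounds {ℓ m : ℕ} (h : ℓ ≤ m) :
    (ℓ : ℝ) + 1 / 2 + (m - ℓ) * (ℓ + 1 / 2) / (2 * ((ℓ + 1 / 2) ^ 2 + (m + 1 / 2))) ≤
        borosMollDefect ℓ m ∧
      borosMollDefect ℓ m ^ 2 ≤ ((ℓ : ℝ) + 1 / 2) ^ 2 + (m - ℓ) := by
  induction h using Nat.decreasingInduction with
  | self => rw [borosMollDefect_self]; simp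
  | of_succ k hk ih =>
    obtain ⟨ih1, ih2⟩ := ih
    have hr := borosMollDefect_succ hk
    have hkm : (k : ℝ) + 1 ≤ m := by exact_mod_cast hk
    have hk0 : (0 : ℝ) ≤ k := k.cast_nonneg
    push_cast at ih1 ih2
    have e1 : (k : ℝ) + 1 + 1 / 2 = k + 1 / 2 + 1 := by ring
    have e2 : (m : ℝ) - (k + 1) = m + 1 / 2 - (k + 1 / 2 + 1) := by ring
    have e3 : (m : ℝ) - k = m + 1 / 2 - (k + 1 / 2) := by ring
    rw [e1, e2] at ih1 ih2
    have hpos : 0 < borosMollDefect (k + 1) m := by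
      refine lt_of_lt_of_le ?_ ih1
      have : (0 : ℝ) ≤ m + 1 / 2 - (k + 1 / 2 + 1) := by linarith
      positivity
    rw [e3]
    refine ⟨riccati_lower_step (by linarith) (by linarith) ih1 hr, ?_⟩
    have := riccati_upper_step (by linarith) (by linarith) hpos
      (ih2.trans_eq (by ring)) hr
    linarith

/-! ### Bounds on the Turán quotients -/

/-- Lower bound for `d_{ℓ-1}(m) d_{ℓ+1}(m) / d_ℓ(m) ^ 2`. -/
noncomputable def turanLower (l m : ℝ) : ℝ := l * (m - l) / ((l + 1) * (m - l + 1))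

/-- Upper bound for `d_{ℓ-1}(m) d_{ℓ+1}(m) / d_ℓ(m) ^ 2`. -/
noncomputable def turanUpper (l m : ℝ) : ℝ :=
  l * (m - l) * ((m + l + 1) * ((l + 1 / 2) ^ 2 + (m + 1 / 2)) - (l + 1 / 2) ^ 2) /
    ((l + 1) * (m - l + 1) * (m + l) * ((l + 1 / 2) ^ 2 + (m + 1 / 2)))

/-- Both neighbours of d_l are multiples of it by factors in w, and the quotient is exactly a
positive factor times (m+1/2)² - w². The upper bound on w thus gives `turanLower`, the lower one
`turanUpper`. -/
theorem borosMoll_turan_bounds {j m : ℕ} (h : j + 1 ≤ m) :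
    turanLower (j + 1 : ℕ) m ≤ borosMoll j m * borosMoll (j + 2) m / borosMoll (j + 1) m ^ 2 ∧
      borosMoll j m * borosMoll (j + 2) m / borosMoll (j + 1) m ^ 2 ≤
        turanUpper (j + 1 : ℕ) m := by
  have h1 := borosMoll_eq_succ (show j < m by omega)
  have h2 := borosMoll_succ_eq h
  obtain ⟨hlo, hhi⟩ := borosMollDefect_bounds h
  have hd := borosMoll_pos h
  have hjm : ((j + 1 : ℕ) : ℝ) ≤ m := by exact_mod_cast h
  have hl0 : (1 : ℝ) ≤ ((j + 1 : ℕ) : ℝ) := by exact_mod_cast Nat.le_add_left 1 j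
  have hj : (j : ℝ) = ((j + 1 : ℕ) : ℝ) - 1 := by push_cast; ring
  rw [hj] at h1
  generalize ((j + 1 : ℕ) : ℝ) = l at *
  set w := borosMollDefect (j + 1) m
  set d := borosMoll (j + 1) m
  set M : ℝ := (m : ℝ)
  have hml : 0 ≤ M - l := by linarith
  have hml1 : 0 < M - l + 1 := by linarith
  have hMl : 0 < M + l := by linarith
  have e : borosMoll j m * borosMoll (j + 2) m / d ^ 2 =
      l * ((M + 1 / 2) ^ 2 - w ^ 2) / ((l + 1) * (M - l + 1) * (M + l)) := by
    rw [div_eq_div_iff (by positivity) (by positivity)]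
    linear_combination ((l + 1) * borosMoll (j + 2) m) * h1 + (l * (M + 1 / 2 + w) * d) * h2
  rw [e]
  constructor
  · unfold turanLower
    rw [div_le_div_iff₀ (by positivity) (by positivity)]
    have : M ^ 2 + M + 1 / 4 - w ^ 2 ≥ (M - l) * (M + l) := by nlinarith
    have h3 : 0 ≤ l * ((l + 1) * (M - l + 1)) := by positivity
    nlinarith [mul_le_mul_of_nonneg_left this h3]
  · unfold turanUpper
    rw [div_le_div_iff₀ (by positivity) (by positivity)]
    have hw2 : (l + 1 / 2) ^ 2 * ((l + 1 / 2) ^ 2 + (M + 1 / 2)) + (M - l) * (l + 1 / 2) ^ 2 ≤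
        w ^ 2 * ((l + 1 / 2) ^ 2 + (M + 1 / 2)) := by
      have hD : 0 < (l + 1 / 2) ^ 2 + (M + 1 / 2) := by positivity
      have hy0 : 0 ≤ (M - l) * (l + 1 / 2) / (2 * ((l + 1 / 2) ^ 2 + (M + 1 / 2))) := by
        positivity
      have hyD : (M - l) * (l + 1 / 2) / (2 * ((l + 1 / 2) ^ 2 + (M + 1 / 2))) *
          ((l + 1 / 2) ^ 2 + (M + 1 / 2)) = (M - l) * (l + 1 / 2) / 2 := by
        generalize (l + 1 / 2) ^ 2 + (M + 1 / 2) = D at hD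
        field_simp
      generalize (M - l) * (l + 1 / 2) / (2 * ((l + 1 / 2) ^ 2 + (M + 1 / 2))) = y at *
      -- Square w ≥ l + 1/2 + y and drop y², which keeps `turanUpper` simple.
      have hsq : (l + 1 / 2) ^ 2 + 2 * (l + 1 / 2) * y ≤ w ^ 2 := by
        nlinarith
      calc _ = ((l + 1 / 2) ^ 2 + 2 * (l + 1 / 2) * y) * ((l + 1 / 2) ^ 2 + (M + 1 / 2)) := by
            linear_combination (-(2 * l + 1)) * hyD
        _ ≤ _ := mul_le_mul_of_nonneg_right hsq hD.le
    have h3 : 0 ≤ l * ((l + 1) * (M - l + 1) * (M + l)) := by positivity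
    have := mul_le_mul_of_nonneg_left hw2 h3
    linear_combination this

/-! ### Positivity on the rectangle of admissible quotients -/

/-- By concavity the quadratic exceeds its chord, by γ(x - lo)(hi - x). -/
theorem quadratic_pos_of_endpoints_pos {α β γ lo hi x : ℝ} (hγ : 0 ≤ γ) (hlo : lo ≤ x)
    (hhi : x ≤ hi) (h1 : 0 < α + β * lo - γ * lo ^ 2) (h2 : 0 < α + β * hi - γ * hi ^ 2) :
    0 < α + β * x - γ * x ^ 2 := by
  rcases hlo.eq_or_lt with rfl | hlo
  · exact h1
  have h : 0 < hi - lo := by linarith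
  refine pos_of_mul_pos_right (a := hi - lo) ?_ h.le
  have h3 := mul_nonneg (sub_nonneg.2 hhi) h1.le
  have h4 := mul_pos (sub_pos.2 hlo) h2
  have h5 := mul_nonneg hγ (mul_nonneg (mul_nonneg (sub_nonneg.2 hhi) (sub_pos.2 hlo).le) h.le)
  linear_combination h3 + h4 + h5

/-- The higher order Turán form in terms of the two consecutive Turán quotients. -/
def turanForm (u v : ℝ) : ℝ := 4 * (1 - u) * (1 - v) - (1 - u * v) ^ 2

theorem turanForm_pos_of_corners {u v u₀ u₁ v₀ v₁ : ℝ} (hu₀ : u₀ ≤ u) (hu₁ : u ≤ u₁)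
    (hv₀ : v₀ ≤ v) (hv₁ : v ≤ v₁) (h00 : 0 < turanForm u₀ v₀) (h01 : 0 < turanForm u₀ v₁)
    (h10 : 0 < turanForm u₁ v₀) (h11 : 0 < turanForm u₁ v₁) : 0 < turanForm u v := by
  have eu : ∀ x y, turanForm x y = (4 * (1 - y) - 1) + (2 * y - 4 * (1 - y)) * x - y ^ 2 * x ^ 2 :=
    fun x y => by unfold turanForm; ring
  have ev : ∀ x y, turanForm x y = (4 * (1 - x) - 1) + (2 * x - 4 * (1 - x)) * y - x ^ 2 * y ^ 2 :=
    fun x y => by unfold turanForm; ring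
  have side : ∀ x, 0 < turanForm x v₀ → 0 < turanForm x v₁ → 0 < turanForm x v := by
    intro x hx0 hx1
    rw [ev] at hx0 hx1 ⊢
    exact quadratic_pos_of_endpoints_pos (sq_nonneg x) hv₀ hv₁ hx0 hx1
  have hs0 := side u₀ h00 h01
  have hs1 := side u₁ h10 h11
  rw [eu] at hs0 hs1 ⊢
  exact quadratic_pos_of_endpoints_pos (sq_nonneg v) hu₀ hu₁ hs0 hs1

theorem turanForm_div_pos {p q r s : ℝ} (hq : 0 < q) (hs : 0 < s)
    (h : 0 < 4 * (q - p) * (s - r) * (q * s) - (q * s - p * r) ^ 2) :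
    0 < turanForm (p / q) (r / s) := by
  have : turanForm (p / q) (r / s) =
      (4 * (q - p) * (s - r) * (q * s) - (q * s - p * r) ^ 2) / (q * s) ^ 2 := by
    unfold turanForm
    field_simp
  rw [this]
  positivity

theorem turanForm_lower_lower_pos {l m : ℝ} (hl : 1 ≤ l) (hm : l + 2 ≤ m) :
    0 < turanForm (turanLower l m) (turanLower (l + 1) m) := by
  -- Shifting to a, b ≥ 0 leaves polynomials with no negative coefficient; the other three corners
  -- work the same way.
  obtain ⟨a, rfl⟩ : ∃ a, l = a + 1 := ⟨l - 1, by ring⟩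
  obtain ⟨b, rfl⟩ : ∃ b, m = a + 1 + 2 + b := ⟨m - (a + 1 + 2), by ring⟩
  have ha : 0 ≤ a := by linarith
  have hb : 0 ≤ b := by linarith
  apply turanForm_div_pos
  · ring_nf; positivity
  · ring_nf; positivity
  · ring_nf; positivity

theorem turanForm_lower_upper_pos {l m : ℝ} (hl : 1 ≤ l) (hm : l + 2 ≤ m) :
    0 < turanForm (turanLower l m) (turanUpper (l + 1) m) := by
  obtain ⟨a, rfl⟩ : ∃ a, l = a + 1 := ⟨l - 1, by ring⟩
  obtain ⟨b, rfl⟩ : ∃ b, m = a + 1 + 2 + b := ⟨m - (a + 1 + 2), by ring⟩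
  have ha : 0 ≤ a := by linarith
  have hb : 0 ≤ b := by linarith
  apply turanForm_div_pos
  · ring_nf; positivity
  · ring_nf; positivity
  · ring_nf; positivity

theorem turanForm_upper_lower_pos {l m : ℝ} (hl : 1 ≤ l) (hm : l + 2 ≤ m) :
    0 < turanForm (turanUpper l m) (turanLower (l + 1) m) := by
  obtain ⟨a, rfl⟩ : ∃ a, l = a + 1 := ⟨l - 1, by ring⟩
  obtain ⟨b, rfl⟩ : ∃ b, m = a + 1 + 2 + b := ⟨m - (a + 1 + 2), by ring⟩
  have ha : 0 ≤ a := by linarith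
  have hb : 0 ≤ b := by linarith
  apply turanForm_div_pos
  · ring_nf; positivity
  · ring_nf; positivity
  · ring_nf; positivity

theorem turanForm_upper_upper_pos {l m : ℝ} (hl : 1 ≤ l) (hm : l + 2 ≤ m) :
    0 < turanForm (turanUpper l m) (turanUpper (l + 1) m) := by
  obtain ⟨a, rfl⟩ : ∃ a, l = a + 1 := ⟨l - 1, by ring⟩
  obtain ⟨b, rfl⟩ : ∃ b, m = a + 1 + 2 + b := ⟨m - (a + 1 + 2), by ring⟩
  have ha : 0 ≤ a := by linarith
  have hb : 0 ≤ b := by linarith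
  apply turanForm_div_pos
  · ring_nf; positivity
  · ring_nf; positivity
  · ring_nf; positivity

theorem theorem1p2 (m ℓ : ℕ) (hm : 3 ≤ m) (hl : 1 ≤ ℓ) (hlm : ℓ ≤ m - 2) :
    4 * (borosMoll ℓ m ^ 2 - borosMoll (ℓ - 1) m * borosMoll (ℓ + 1) m) *
        (borosMoll (ℓ + 1) m ^ 2 - borosMoll ℓ m * borosMoll (ℓ + 2) m) >
      (borosMoll ℓ m * borosMoll (ℓ + 1) m -
        borosMoll (ℓ - 1) m * borosMoll (ℓ + 2) m) ^ 2 := by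
  obtain ⟨j, rfl⟩ : ∃ j, ℓ = j + 1 := ⟨ℓ - 1, by omega⟩
  obtain ⟨hu0, hu1⟩ := borosMoll_turan_bounds (show j + 1 ≤ m by omega)
  obtain ⟨hv0, hv1⟩ := borosMoll_turan_bounds (show j + 1 + 1 ≤ m by omega)
  have hl1 : (1 : ℝ) ≤ ((j + 1 : ℕ) : ℝ) := by exact_mod_cast hl
  have hm2 : ((j + 1 : ℕ) : ℝ) + 2 ≤ m := by
    have : j + 1 + 2 ≤ m := by omega
    exact_mod_cast this
  rw [Nat.cast_succ (j + 1)] at hv0 hv1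
  have hpos := turanForm_pos_of_corners hu0 hu1 hv0 hv1 (turanForm_lower_lower_pos hl1 hm2)
    (turanForm_lower_upper_pos hl1 hm2) (turanForm_upper_lower_pos hl1 hm2)
    (turanForm_upper_upper_pos hl1 hm2)
  have hb := borosMoll_pos (show j + 1 ≤ m by omega)
  have hc := borosMoll_pos (show j + 1 + 1 ≤ m by omega)
  rw [Nat.add_sub_cancel, gt_iff_lt, ← sub_pos]
  -- Multiplying by d_ℓ² d_{ℓ+1}² undoes the normalisation, since uv = d_{ℓ-1}d_{ℓ+2}/(d_ℓ d_{ℓ+1}).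
  have hmul := mul_pos (mul_pos (pow_pos hb 2) (pow_pos hc 2)) hpos
  refine lt_of_lt_of_eq hmul ?_
  unfold turanForm
  rw [show j + 2 = j + 1 + 1 from rfl]
  generalize borosMoll (j + 1) m = x at *
  generalize borosMoll (j + 1 + 1) m = y at *
  field_simp
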